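/- Let $G$ be a graph with finitely many edges (loops and multiple edges allowed). For every vertex $v$ and every end of an edge $e$ at $v$ let $u^{(v)}_e$ be a vertex spin rotation; passing through $v$ from $e$ to $f$ produces the spin transformation $u^{ef}=(u^{(v)}_e)^{-1}u^{(v)}_f$. For a periodic orbit $p=(e_1,\dots,e_n)$ (a nonempty cyclic sequence of directed edges, each starting at the vertex where the previous one ends) put $d_p=u^{e_1e_2}u^{e_2e_3}\cdots u^{e_ne_1}$. Let $\Gamma\subseteq \mathrm{SU}(2)$ be a subgroup that acts irreducibly on $\mathbb C^2$ and carries a Haar probability measure (for instance a compact one), and let the rotations $u^{(v)}_e$ be independent and distributed according to this measure. Write $\langle d_p,d_q\rangle_\Gamma$ for the expectation of $\operatorname{tr}(d_p)\operatorname{tr}(d_q)$. Let $p$ and $q$ be periodic orbits such that $q$ is obtained from $p$ by permuting and/or reversing arcs: for some $k\ge 1$, as cyclic sequences, $p=a_1a_2\cdots a_k$ with nonempty arcs $a_i$, and $q=a_{\pi(1)}^{\pm}a_{\pi(2)}^{\pm}\cdots a_{\pi(k)}^{\pm}$, where $\pi$ is a permutation, the signs are arbitrary, and $a^{-}$ denotes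 the arc $a$ traversed backwards. Assume that every arc $a_i$ contains an edge that $p$ traverses exactly once (both directions being counted). Then $$\langle d_p,d_q\rangle_\Gamma=\left(-\tfrac12\right)^{m-1},$$ where $m-1$ is the number of self-intersections at which $p$ has been rearranged to produce $q$, an $l$-fold self-intersection being counted as $l-1$. Precisely, call the $k$ passages of $p$ from an arc to the cyclically next one junctions; declare two junctions equivalent if they are linked by a chain of connections that $q$ makes between the ends of the arcs. A class of $l$ junctions is an $l$-fold self-intersection, and $m-1=\sum_{c}(|c|-1)$, the sum being over the classes $c$. -/

import Mathlib

open MeasureTheory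

/-- A graph with vertices `V` and edges `E`; loops and multiple edges are allowed.  Every edge
carries a coordinate, hence an initial vertex `src` and a terminal vertex `tgt`. -/
structure OrientedGraph (V E : Type*) where
  src : E → V
  tgt : E → V

/-- A directed edge (bond): an edge together with the direction in which it is traversed
(`true` is the direction from `src` to `tgt`). -/
abbrev Bond (E : Type*) : Type _ := E × Bool

namespace Bond

variable {E : Type*}

/-- The same edge, traversed in the other direction. -/
def rev (b : Bond E) : Bond E := (b.1, !b.2)

end Bond

namespace OrientedGraph

variable {V E : Type*}

/-- The vertex at which a directed edge starts. -/
def origin (G : OrientedGraph V E) (b : Bond E) : V := if b.2 then G.src b.1 else G.tgt b.1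

/-- The vertex at which a directed edge ends. -/
def terminus (G : OrientedGraph V E) (b : Bond E) : V := G.origin b.rev

end OrientedGraph

/-- The cyclically consecutive pairs `(e₁,e₂), (e₂,e₃), …, (eₙ,e₁)` of `(e₁,…,eₙ)`. -/
def cyclicPairs {α : Type*} (p : List α) : List (α × α) := p.zip (p.rotate 1)

/-- A periodic orbit: a nonempty cyclic sequence of directed edges in which each edge starts at
the vertex where the previous one ends. -/
def OrientedGraph.IsPeriodicOrbit {V E : Type*} (G : OrientedGraph V E) (p : List (Bond E)) :
    Prop :=
  p ≠ [] ∧ ∀ x ∈ cyclicPairs p, G.terminus x.1 = G.origin x.2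

/-- The spin transformation `u^{ef} = (u_e)⁻¹ u_f` acquired in passing a vertex `v` from the
edge `e` to the edge `f`.  The vertex spin rotations `u_e = u_e^{(v)}` are indexed by the ends of
edges at vertices; the end of an edge at `v` is named by the bond that leaves `v` through it.  So
for a bond `b` arriving at `v` and a bond `c` leaving `v` the two rotations are `u b.rev`, `u c`. -/
def spinTransition {E H : Type*} [Group H] (u : Bond E → H) (b c : Bond E) : H :=
  (u b.rev)⁻¹ * u c

/-- The spin rotation `d_p = u^{e₁e₂} u^{e₂e₃} ⋯ u^{eₙe₁}` of a periodic orbit `p = (e₁,…,eₙ)`. -/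
def orbitSpin {E H : Type*} [Group H] (u : Bond E → H) (p : List (Bond E)) : H :=
  ((cyclicPairs p).map fun x => spinTransition u x.1 x.2).prod

/-- The sequence of bonds traversed backwards. -/
def reverseArc {E : Type*} (a : List (Bond E)) : List (Bond E) := (a.map Bond.rev).reverse

/-- `q` is obtained from `p` by permuting and/or reversing arcs: as cyclic sequences, `p` is the
concatenation of the arcs `arc 0, arc 1, …, arc (k-1)`, and `q` is the concatenation of the arcs
`arc (perm 0), arc (perm 1), …, arc (perm (k-1))`, the `j`-th of them traversed backwards
if `flip j` is `true`. -/
structure ArcRearrangement {E : Type*} (p q : List (Bond E)) where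
  k : ℕ
  k_ne_zero : k ≠ 0
  arc : Fin k → List (Bond E)
  arc_ne_nil : ∀ i, arc i ≠ []
  perm : Equiv.Perm (Fin k)
  flip : Fin k → Bool
  p_eq : p.IsRotated (List.ofFn arc).flatten
  q_eq : q.IsRotated
    (List.ofFn fun j => if flip j then reverseArc (arc (perm j)) else arc (perm j)).flatten

namespace ArcRearrangement

variable {E : Type*} {p q : List (Bond E)} (R : ArcRearrangement p q)

/- Junction `i` is the passage of `p` from arc `i` to the (cyclically) next arc.  It is the final
end of arc `i` in `p`, and the initial end of the next arc. -/

/-- The junction of `p` at which `q` enters its `j`-th arc. -/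
def entryJunction (j : Fin R.k) : Fin R.k :=
  if R.flip j then R.perm j else (finRotate R.k).symm (R.perm j)

/-- The junction of `p` at which `q` leaves its `j`-th arc. -/
def exitJunction (j : Fin R.k) : Fin R.k :=
  if R.flip j then (finRotate R.k).symm (R.perm j) else R.perm j

/-- Two junctions of `p` belong to the same self-intersection if they are joined by a chain of
connections that `q` makes between the ends of the arcs. -/
def intersectionSetoid : Setoid (Fin R.k) :=
  Relation.EqvGen.setoid fun x y =>
    ∃ j, x = R.exitJunction j ∧ y = R.entryJunction (finRotate R.k j)

/-- The self-intersections at which the arcs are reconnected, as classes of junctions.  A class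
of `l` junctions is an `l`-fold self-intersection (`p` passes `l` times through its vertex); for
`l = 1` the orbit `q` makes the same connection as `p`. -/
abbrev Intersection : Type := Quotient R.intersectionSetoid

/-- The number of passages of `p` through a self-intersection. -/
noncomputable def multiplicity (c : R.Intersection) : ℕ :=
  Nat.card {i : Fin R.k // Quotient.mk R.intersectionSetoid i = c}

/-- The number of self-intersections at which `p` has been rearranged to produce `q`, where an
`l`-fold self-intersection counts as `l - 1` (so an ordinary, double, one counts once, and
a junction at which nothing is changed does not count). -/
noncomputable def numSelfIntersections : ℕ :=
  ∑ᶠ c : R.Intersection, (R.multiplicity c - 1)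

end ArcRearrangement

/-- The group `SU(2)`. -/
abbrev SU2 : Type := Matrix.specialUnitaryGroup (Fin 2) ℂ

/-- The spin representation of a subgroup of `SU(2)`: its action on `ℂ²`. -/
noncomputable def spinRepresentation (Γ : Subgroup SU2) : Representation ℂ Γ (Fin 2 → ℂ) :=
  ((Matrix.toLinAlgEquiv' : Matrix (Fin 2) (Fin 2) ℂ ≃ₐ[ℂ] _) : _ →* _).comp
    ((Matrix.specialUnitaryGroup (Fin 2) ℂ).subtype.comp Γ.subtype)

/-- The trace of an element of a subgroup of `SU(2)`, as a `2 × 2` matrix. -/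
noncomputable def spinTrace {Γ : Subgroup SU2} (g : Γ) : ℂ :=
  Matrix.trace ((g : SU2) : Matrix (Fin 2) (Fin 2) ℂ)

/-- The spin contribution `⟨tr d_p · tr d_q⟩_Γ`: the average over independent vertex spin
rotations, each with law `μ` on `Γ`. -/
noncomputable def spinAverage {E : Type*} [Fintype E] (Γ : Subgroup SU2) [MeasurableSpace Γ]
    (μ : Measure Γ) (p q : List (Bond E)) : ℂ :=
  ∫ u : Bond E → Γ, spinTrace (orbitSpin u p) * spinTrace (orbitSpin u q)
    ∂(Measure.pi fun _ => μ)

/-! Up to cyclic rotation, the trace of `d_p` is the trace of a product over bonds of `u b * (u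
b.rev)⁻¹`, and reversing an arc inverts its factor. Condition on every rotation except one at a
once-traversed edge of each arc: arc `i` becomes `L i * s i * X i`, with the `s i` independent and
Haar distributed. Expand both traces in spin indices, `x` at the junctions of `p` and `y` at the
connections of `q`; the average then factorises over the arcs. By Schur's lemma each arc contributes
half a product of two antisymmetric forms if `q` keeps its direction, or of two Kronecker deltas if
`q` reverses it (`integral_spinMatrix_mul`, `integral_spinMatrix_mul_inv`).

What remains is combinatorial. The arc ends, matched in pairs by junctions and again by connections,
form closed loops, one for each class of junctions. Each loop has one free spin, so `v` classes give
`2 ^ v` nonvanishing configurations (`card_compatible`). All have the same sign: orienting the loops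
makes them the cycles of a permutation of the `k` junctions, and its sign `(-1) ^ (k - v)` is the
product of the signs of the forms (`exists_perm_of_compatible`). Altogether `2 ^ (-k) * (-1) ^ (k -
v) * 2 ^ v = (-1/2) ^ (k - v)`, and `k - v` is the sum of `|c| - 1` over the classes. -/

/-! ### Signs of permutations and pairs of matchings. -/

open Equiv Equiv.Perm in
/-- The sign of a permutation is determined by the number of its orbits. -/
theorem sign_eq_neg_one_pow_card_sub_card_quotient {α : Type*} [Fintype α] [DecidableEq α]
    (f : Perm α) :
    sign f = (-1) ^ (Fintype.card α - Nat.card (Quotient (SameCycle.setoid f))) := by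
  classical
  -- Cycle classes are the fibres of `h`: fixed points on the left, nontrivial cycle factors on the
  -- right.
  let h : α → α ⊕ Perm α := fun x => if f x = x then Sum.inl x else Sum.inr (f.cycleOf x)
  have hker : SameCycle.setoid f = Setoid.ker h := by
    ext x y
    change f.SameCycle x y ↔ h x = h y
    by_cases hx : f x = x <;> by_cases hy : f y = y <;> simp only [h, hx, hy, if_true, if_false]
    · simp only [Sum.inl.injEq]
      exact ⟨fun H => H.eq_of_left hx, fun H => H ▸ SameCycle.refl f x⟩
    · simp only [reduceCtorEq, iff_false]
      exact fun H => hy (H.apply_eq_self_iff.1 hx)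
    · simp only [reduceCtorEq, iff_false]
      exact fun H => hx (H.apply_eq_self_iff.2 hy)
    · rw [Sum.inr.injEq, ← sameCycle_iff_cycleOf_eq_of_mem_support (mem_support.2 hx)
        (mem_support.2 hy)]
  have hrange : Set.range h =
      (((Finset.univ.filter fun x => f x = x).disjSum f.cycleFactorsFinset :
        Finset (α ⊕ Perm α)) : Set (α ⊕ Perm α)) := by
    ext z
    rcases z with x | g
    · simp only [Set.mem_range, SetLike.mem_coe, Finset.inl_mem_disjSum, Finset.mem_filter,
        Finset.mem_univ, true_and, h]
      constructor
      · rintro ⟨y, hy⟩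
        split_ifs at hy with H
        exact (Sum.inl.inj hy) ▸ H
      · exact fun H => ⟨x, by simp [H]⟩
    · simp only [Set.mem_range, SetLike.mem_coe, Finset.inr_mem_disjSum, h]
      constructor
      · rintro ⟨y, hy⟩
        split_ifs at hy with H
        rw [← Sum.inr.inj hy, cycleOf_mem_cycleFactorsFinset_iff]
        exact mem_support.2 H
      · intro H
        obtain ⟨a, ha⟩ := (mem_cycleFactorsFinset_iff.1 H).1.nonempty_support
        have hfa : f a ≠ a := mem_support.1 (mem_cycleFactorsFinset_support_le H ha)
        exact ⟨a, by rw [if_neg hfa, cycle_is_cycleOf ha H]⟩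
  have hcard : Nat.card (Quotient (SameCycle.setoid f)) =
      (Fintype.card α - f.support.card) + f.cycleFactorsFinset.card := by
    rw [hker, Nat.card_congr (Setoid.quotientKerEquivRange h), Nat.card_coe_set_eq, hrange,
      Set.ncard_coe_finset, Finset.card_disjSum, ← Finset.card_compl]
    congr 2
    ext x
    simp
  have hs := f.support.card_le_univ
  have hcc : Multiset.card f.cycleType = f.cycleFactorsFinset.card := by
    simp [cycleType_def]
  have hle : f.cycleFactorsFinset.card ≤ f.support.card := by
    rw [← sum_cycleType, ← hcc]
    exact (Multiset.card_nsmul_le_sum (a := 1) fun x hx =>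
      (one_lt_of_mem_cycleType hx).le).trans' (by simp)
  rw [sign_of_cycleType, hcard, sum_cycleType, hcc]
  -- The exponent of `sign_of_cycleType` exceeds the wanted one by twice the number of nontrivial
  -- cycles.
  have : f.support.card + f.cycleFactorsFinset.card =
      (Fintype.card α - (Fintype.card α - f.support.card + f.cycleFactorsFinset.card))
        + 2 * f.cycleFactorsFinset.card := by omega
  rw [this, pow_add, pow_mul]
  simp

open Equiv Equiv.Perm in
/-- The union of two perfect matchings is bipartite. -/
theorem exists_bool_coloring_of_involutive {S : Type*} [Finite S] {P Q : S → S}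
    (hP : Function.Involutive P) (hQ : Function.Involutive Q) (hP' : ∀ s, P s ≠ s)
    (hQ' : ∀ s, Q s ≠ s) : ∃ o : S → Bool, ∀ s, o (P s) = !o s ∧ o (Q s) = !o s := by
  let T : Perm S := hQ.toPerm * hP.toPerm
  have hT : ∀ s, T s = Q (P s) := fun _ => rfl
  -- `P` conjugates `T` to its inverse.
  have hpow : ∀ (n : ℕ) s, (T ^ n) (P ((T ^ n) s)) = P s := by
    intro n
    induction n with
    | zero => simp
    | succ n ih =>
      intro s
      have h1 : ∀ a, (T ^ (n + 1)) a = (T ^ n) (T a) := fun a => by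
        rw [pow_succ, Perm.mul_apply]
      have h2 : ∀ a, (T ^ (n + 1)) a = T ((T ^ n) a) := fun a => by
        rw [pow_succ', Perm.mul_apply]
      rw [h1, h2 s, hT, hT, hP, hQ, ih]
  -- If `T ^ i` took `s` to `P s`, then halfway along, according to the parity of `i`, there would
  -- be a fixed point of `P` or of `Q`.
  have hne : ∀ s, ¬ T.SameCycle s (P s) := by
    intro s hs
    obtain ⟨i, hi⟩ := hs.exists_nat_pow_eq
    obtain ⟨m, rfl | rfl⟩ := i.even_or_odd'
    · rw [two_mul, pow_add, Perm.mul_apply, ← hpow m s] at hi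
      exact hP' _ ((T ^ m).injective hi).symm
    · rw [show 2 * m + 1 = m + (1 + m) by ring, pow_add, pow_add, pow_one,
        Perm.mul_apply, Perm.mul_apply, ← hpow m s] at hi
      exact hQ' _ ((T ^ m).injective hi)
  -- `P` and `Q` both exchange the cycle of `s` with a different one. Numbering the cycles decides
  -- which of the two gets which colour.
  obtain ⟨enc, henc⟩ := exists_injective_nat (Quotient (SameCycle.setoid T))
  have hPQ : ∀ s, T.SameCycle (P (Q s)) s := fun s => by
    have : T (P (Q s)) = s := by rw [hT, hP, hQ]
    exact sameCycle_apply_left.1 (by rw [this])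
  have hQP : ∀ s, T.SameCycle (Q s) (P s) := fun s => by
    have := hT (P s)
    rw [hP] at this
    rw [← this]; exact sameCycle_apply_left.2 (SameCycle.refl T _)
  let cl : S → ℕ := fun s => enc (Quotient.mk (SameCycle.setoid T) s)
  have hcl : ∀ {s t}, cl s = cl t ↔ T.SameCycle s t := fun {s t} =>
    henc.eq_iff.trans Quotient.eq
  have hcne : ∀ s, cl s ≠ cl (P s) := fun s H => hne s (hcl.1 H)
  refine ⟨fun s => decide (cl s < cl (P s)), fun s => ⟨?_, ?_⟩⟩
  · dsimp only
    rw [hP, ← decide_not]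
    have := hcne s
    congr 1
    simp only [eq_iff_iff]
    omega
  · dsimp only
    rw [hcl.2 (hPQ s), hcl.2 (hQP s), ← decide_not]
    have := hcne s
    congr 1
    simp only [eq_iff_iff]
    omega

/-- The sign attached to a Boolean: `-1` for `true`. -/
def boolSign (b : Bool) : ℤˣ := if b then -1 else 1

@[simp] theorem boolSign_xor (a b : Bool) : boolSign (xor a b) = boolSign a * boolSign b := by
  cases a <;> cases b <;> simp [boolSign]

@[simp] theorem boolSign_not (a : Bool) : boolSign (!a) = -boolSign a := by
  cases a <;> simp [boolSign]

@[simp] theorem boolSign_mul_self (a : Bool) : boolSign a * boolSign a = 1 := by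
  cases a <;> simp [boolSign]

/-! ### Combinatorics of the gluing: loops, spin indices and signs. -/

namespace ArcGluing

open Equiv

variable {ι : Type*} (c π : Perm ι) (flip : ι → Bool)

/-- The junction at which the `j`-th rearranged arc is entered. -/
def entry (j : ι) : ι := if flip j then π j else c.symm (π j)

/-- The junction at which the `j`-th rearranged arc is left. -/
def exit (j : ι) : ι := if flip j then c.symm (π j) else π j

/-- The relation between spin indices `x` at the junctions and `y` at the connections under which
every arc contributes to the contraction. -/
def Compatible (x y : ι → Bool) : Prop :=
  ∀ j, y j = xor (x (exit c π flip j)) (!flip j) ∧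
    y (c.symm j) = xor (x (entry c π flip j)) (!flip j)

/-- The equivalence relation generated by the connections. -/
def connectionSetoid : Setoid ι :=
  Relation.EqvGen.setoid fun a b => ∃ j, a = exit c π flip j ∧ b = entry c π flip (c j)

/-- Flip the second component wherever `f` says so. -/
def xorPerm (f : ι → Bool) : Perm (ι × Bool) :=
  Equiv.prodCongrRight fun i => if f i then Equiv.boolNot else 1

theorem xorPerm_apply (f : ι → Bool) (i : ι) (b : Bool) :
    xorPerm f (i, b) = (i, xor b (f i)) := by
  cases h : f i <;> simp [xorPerm, h]

/-- Arc ends, labelled by arc and side, relabelled by junction and side. -/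
def junctionPerm : Perm (ι × Bool) :=
  Equiv.prodCongrLeft fun b => if b then 1 else c⁻¹

theorem junctionPerm_true (i : ι) : junctionPerm c (i, true) = (i, true) := by
  simp [junctionPerm]

theorem junctionPerm_false (i : ι) : junctionPerm c (i, false) = (c.symm i, false) := by
  simp [junctionPerm]

/-- Arc ends, labelled by arc and side, relabelled by position and passage of the rearrangement. -/
def positionPerm : Perm (ι × Bool) :=
  xorPerm flip * Equiv.prodCongrLeft fun _ => π⁻¹

theorem positionPerm_apply (j : ι) (b : Bool) :
    positionPerm π flip (π j, b) = (j, xor b (flip j)) := by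
  simp [positionPerm, xorPerm_apply]

section Sign

variable [Fintype ι] [DecidableEq ι]

theorem sign_xorPerm (f : ι → Bool) : Perm.sign (xorPerm f) = ∏ i, boolSign (f i) := by
  rw [xorPerm, Perm.sign_prodCongrRight]
  refine Finset.prod_congr rfl fun i _ => ?_
  cases f i
  · simp [boolSign]
  · simp only [if_true, boolSign]; decide

theorem sign_junctionPerm : Perm.sign (junctionPerm c) = Perm.sign c := by
  rw [junctionPerm, Perm.sign_prodCongrLeft]
  simp

theorem sign_positionPerm : Perm.sign (positionPerm π flip) = ∏ i, boolSign (flip i) := by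
  rw [positionPerm, map_mul, sign_xorPerm, Perm.sign_prodCongrLeft]
  simp

variable {c π flip}

/-- The junctions, in the order in which the oriented loops of the gluing visit them. -/
theorem exists_perm_of_compatible {x y : ι → Bool} (h : Compatible c π flip x y) :
    ∃ τ : Perm ι, Perm.SameCycle.setoid τ = connectionSetoid c π flip ∧
      Perm.sign τ = ∏ j, if flip j then 1 else boolSign (x (c.symm (π j))) * boolSign (x (π j)) := by
  -- `A` sends an arc end to its junction, `B` to its connection. The Boolean of the image orients
  -- the end, and compatibility says that both give the same orientation.
  let A : Perm (ι × Bool) := xorPerm (fun i => !x i) * junctionPerm c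
  let B : Perm (ι × Bool) := xorPerm y * (junctionPerm c * positionPerm π flip)
  have hA1 : ∀ i, A (i, true) = (i, x i) := fun i => by
    simp [A, junctionPerm_true, xorPerm_apply]
  have hA2 : ∀ i, A (i, false) = (c.symm i, !x (c.symm i)) := fun i => by
    simp [A, junctionPerm_false, xorPerm_apply]
  have hB1 : ∀ j, B (π j, !flip j) = (j, !y j) := fun j => by
    simp [B, positionPerm_apply, junctionPerm_true, xorPerm_apply]
  have hB2 : ∀ j, B (π j, flip j) = (c.symm j, y (c.symm j)) := fun j => by
    simp [B, positionPerm_apply, junctionPerm_false, xorPerm_apply]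
  have hAB1 : ∀ j, A (π j, !flip j) = (exit c π flip j, !y j) := fun j => by
    rw [(h j).1, exit]
    cases flip j <;> simp [hA1, hA2]
  have hAB2 : ∀ j, A (π j, flip j) = (entry c π flip j, y (c.symm j)) := fun j => by
    rw [(h j).2, entry]
    cases flip j <;> simp [hA1, hA2]
  have hAB : ∀ s, (A s).2 = (B s).2 := by
    rintro ⟨i, b⟩
    obtain ⟨j, rfl⟩ := π.surjective i
    rcases Bool.eq_or_eq_not b (flip j) with rfl | rfl
    · rw [hB2, hAB2]
    · rw [hB1, hAB1]
  let M : Perm (ι × Bool) := A * B⁻¹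
  have hMB : ∀ s, M (B s) = A s := fun s => by simp [M]
  have hM2 : ∀ s, (M s).2 = s.2 := fun s => by
    have := hAB (B⁻¹ s)
    simpa [M] using this
  have hMe : ∀ j b, M (j, b) = ((M (j, b)).1, b) := fun j b => Prod.ext rfl (hM2 _)
  have hinj : ∀ b, Function.Injective fun j => (M (j, b)).1 := by
    intro b j j' hj
    have : M (j, b) = M (j', b) := Prod.ext hj (by rw [hM2, hM2])
    exact congrArg Prod.fst (M.injective this)
  -- `ρ b` takes a connection to the junction at its end of orientation `b`. Hence `ρ true * (ρ
  -- false)⁻¹` moves along the oriented loop from one junction to the next.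
  let ρ : Bool → Perm ι := fun b =>
    Equiv.ofBijective _ (Finite.injective_iff_bijective.1 (hinj b))
  have hρ : ∀ b j, ρ b j = (M (j, b)).1 := fun _ _ => rfl
  have hMρ : M = Equiv.prodCongrLeft ρ := by
    ext1 ⟨j, b⟩
    rw [hMe, Equiv.prodCongrLeft_apply, hρ]
  have hρ1 : ∀ j, ρ (!y j) j = exit c π flip j := fun j => by
    rw [hρ, ← hB1, hMB, hAB1]
  have hρ2 : ∀ j, ρ (y j) j = entry c π flip (c j) := fun j => by
    have := hB2 (c j)
    rw [Equiv.symm_apply_apply] at this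
    rw [hρ, ← this, hMB, hAB2]
  refine ⟨ρ true * (ρ false)⁻¹, ?_, ?_⟩
  · have hstep : ∀ j, (ρ true * (ρ false)⁻¹) (ρ false j) = ρ true j := fun j => by simp
    apply le_antisymm
    · rintro a b ⟨n, rfl⟩
      have key : ∀ a, connectionSetoid c π flip a ((ρ true * (ρ false)⁻¹) a) := by
        intro a
        obtain ⟨j, rfl⟩ := (ρ false).surjective a
        rw [hstep]
        have : connectionSetoid c π flip (ρ (!y j) j) (ρ (y j) j) := by
          rw [hρ1, hρ2]
          exact Relation.EqvGen.rel _ _ ⟨j, rfl, rfl⟩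
        cases hy : y j <;> simp only [hy, Bool.not_true, Bool.not_false] at this
        · exact this.symm
        · exact this
      induction n using Int.induction_on generalizing a with
      | zero => exact Setoid.refl' _ _
      | succ n ih =>
        rw [zpow_add_one, Perm.mul_apply]
        exact Setoid.trans' _ (key a) (@ih _)
      | pred n ih =>
        rw [zpow_sub_one, Perm.mul_apply]
        refine Setoid.trans' _ (Setoid.symm' _ ?_) (@ih _)
        simpa using key ((ρ true * (ρ false)⁻¹)⁻¹ a)
    · refine Setoid.eqvGen_le ?_
      rintro a b ⟨j, rfl, rfl⟩
      change Perm.SameCycle _ _ _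
      rw [← hρ1, ← hρ2]
      cases y j
      · rw [Bool.not_false, ← hstep]
        exact (Perm.sameCycle_apply_left).2 (Perm.SameCycle.refl _ _)
      · rw [Bool.not_true, ← hstep]
        exact (Perm.sameCycle_apply_right).2 (Perm.SameCycle.refl _ _)
  · have hs : Perm.sign (ρ true * (ρ false)⁻¹) = Perm.sign A * Perm.sign B := by
      have : Perm.sign M = Perm.sign (ρ true) * Perm.sign (ρ false) := by
        rw [hMρ, Perm.sign_prodCongrLeft, Fintype.prod_bool]
      rw [map_mul, Perm.sign_inv, ← this]
      simp [M]
    rw [hs]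
    simp only [A, B, map_mul, sign_xorPerm, sign_junctionPerm, sign_positionPerm]
    have e1 : (∏ i, boolSign (!x i)) * (∏ j, boolSign (y j)) * ∏ j, boolSign (flip j) =
        ∏ j, if flip j then 1 else boolSign (x (c.symm (π j))) * boolSign (x (π j)) := by
      -- `exit` need not be a bijection; the second factor corrects the reversed arcs, where it
      -- differs from `π`.
      have e2 : ∏ i, boolSign (!x i) = ∏ j, boolSign (!x (exit c π flip j)) *
          (if flip j then (boolSign (x (π j)) * boolSign (x (c.symm (π j)))) else 1) := by
        rw [← Equiv.prod_comp π]
        refine Finset.prod_congr rfl fun j _ => ?_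
        cases hf : flip j <;> simp only [exit, hf, boolSign_not] <;> simp
        rw [mul_comm, mul_assoc, boolSign_mul_self, mul_one]
      have e3 : (∏ j, boolSign (x (π j))) * (∏ j, boolSign (x (c.symm (π j)))) = 1 := by
        rw [Equiv.prod_comp π (fun j => boolSign (x j)),
          Equiv.prod_comp π (fun j => boolSign (x (c.symm j))),
          Equiv.prod_comp c.symm (fun j => boolSign (x j)), ← Finset.prod_mul_distrib]
        simp
      have e4 : ∀ a b : ℤˣ, a * b = 1 → a = b := fun a b hab => by
        rw [eq_inv_of_mul_eq_one_left hab, Int.units_inv_eq_self]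
      apply e4
      refine Eq.trans ?_ e3
      rw [e2]
      simp only [← Finset.prod_mul_distrib]
      refine Finset.prod_congr rfl fun j _ => ?_
      rw [(h j).1]
      cases hf : flip j <;> simp only [exit, hf, if_true, Bool.false_eq_true, if_false] <;>
        generalize x (π j) = a <;> generalize x (c.symm (π j)) = b <;>
        cases a <;> cases b <;> simp [boolSign]
    rw [← e1]
    calc _ = (∏ i, boolSign (!x i)) * (∏ j, boolSign (y j)) * (∏ j, boolSign (flip j)) *
          (Perm.sign c * Perm.sign c) := by
            simp only [mul_comm, mul_left_comm, mul_assoc]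
      _ = _ := by rw [Int.units_mul_self, mul_one]

end Sign

section Existence

variable [Finite ι]

theorem exists_compatible : ∃ x y, Compatible c π flip x y := by
  -- `P` matches the two ends at a junction of `p`, and `Q` below the two ends at a connection of
  -- `q`. A 2-colouring of the ends yields `x` and `y`.
  let P : ι × Bool → ι × Bool := fun s => if s.2 then (c s.1, false) else (c.symm s.1, true)
  have hP : Function.Involutive P := by rintro ⟨i, b⟩; cases b <;> simp [P]
  have hPne : ∀ s, (P s).2 ≠ s.2 := by rintro ⟨i, b⟩; cases b <;> simp [P]
  let E := positionPerm π flip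
  let Q : ι × Bool → ι × Bool := fun s => E.symm (P (E s))
  have hQ : Function.Involutive Q := fun s => by simp [Q, hP (E s)]
  obtain ⟨o, ho⟩ := exists_bool_coloring_of_involutive hP hQ
    (fun s h => hPne s (congrArg Prod.snd h))
    (fun s h => hPne (E s) (congrArg Prod.snd (E.symm_apply_eq.1 h)))
  refine ⟨fun i => o (i, true), fun j => !o (π j, !flip j), fun j => ⟨?_, ?_⟩⟩
  · dsimp only [exit]
    cases flip j
    · simp
    · have := (ho (π j, false)).1
      simp only [P, Bool.false_eq_true, if_false] at this
      simp [this]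
  · have h1 : Q (π (c.symm j), !flip (c.symm j)) = (π j, flip j) := by
      simp [Q, E, Equiv.symm_apply_eq, positionPerm_apply, P]
    dsimp only [entry]
    rw [← (ho _).2, h1]
    cases flip j
    · have := (ho (π j, false)).1
      simp only [P, Bool.false_eq_true, if_false] at this
      simp [this]
    · simp

variable {c π flip}

/-- Compatible spin indices are determined by one spin for every class of junctions. -/
theorem card_compatible :
    Nat.card {z : (ι → Bool) × (ι → Bool) // Compatible c π flip z.1 z.2} =
      2 ^ Nat.card (Quotient (connectionSetoid c π flip)) := by
  obtain ⟨x₀, y₀, h₀⟩ := exists_compatible c π flip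
  let mk : ι → Quotient (connectionSetoid c π flip) := Quotient.mk _
  have hmk : ∀ j, mk (exit c π flip j) = mk (entry c π flip (c j)) := fun j =>
    Quotient.sound (Relation.EqvGen.rel _ _ ⟨j, rfl, rfl⟩)
  -- The compatible pairs form a torsor: the difference of two of them is constant on classes.
  have e : (Quotient (connectionSetoid c π flip) → Bool) ≃
      {z : (ι → Bool) × (ι → Bool) // Compatible c π flip z.1 z.2} := by
    refine Equiv.ofBijective (fun t => ⟨(fun i => xor (x₀ i) (t (mk i)),
      fun j => xor (y₀ j) (t (mk (exit c π flip j)))), fun j => ⟨?_, ?_⟩⟩) ⟨?_, ?_⟩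
    · simp only [(h₀ j).1]
      rw [Bool.xor_right_comm]
    · have := hmk (c.symm j)
      rw [Equiv.apply_symm_apply] at this
      simp only [(h₀ j).2, this]
      rw [Bool.xor_right_comm]
    · intro t t' h
      funext q
      obtain ⟨i, rfl⟩ := Quotient.exists_rep q
      have := congrFun (congrArg (fun z => z.1.1) h) i
      simpa using this
    · rintro ⟨⟨x, y⟩, h⟩
      dsimp only at h
      have hstep : ∀ a b, connectionSetoid c π flip a b → xor (x₀ a) (x a) = xor (x₀ b) (x b) := by
        have : connectionSetoid c π flip ≤ Setoid.ker fun a => xor (x₀ a) (x a) := by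
          refine Setoid.eqvGen_le ?_
          rintro a b ⟨j, rfl, rfl⟩
          change xor _ _ = xor _ _
          have h1 := (h j).1
          have h2 := (h (c j)).2
          have h3 := (h₀ j).1
          have h4 := (h₀ (c j)).2
          rw [Equiv.symm_apply_apply] at h2 h4
          rw [h1] at h2
          rw [h3] at h4
          revert h2 h4
          generalize x (exit c π flip j) = a, x₀ (exit c π flip j) = a',
            x (entry c π flip (c j)) = b, x₀ (entry c π flip (c j)) = b', flip j = d,
            flip (c j) = e
          revert a a' b b' d e
          decide
        exact fun a b hab => this hab
      refine ⟨Quotient.lift (fun a => xor (x₀ a) (x a)) hstep, ?_⟩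
      ext i
      · simp [mk]
      · simp [mk, (h i).1, (h₀ i).1]
        generalize x (exit c π flip i) = a, x₀ (exit c π flip i) = a', flip i = d
        revert a a' d
        decide
  rw [← Nat.card_congr e, Nat.card_fun]
  simp

theorem card_quotient_le :
    Nat.card (Quotient (connectionSetoid c π flip)) ≤ Nat.card ι :=
  Nat.card_le_card_of_surjective _ Quotient.mk_surjective

end Existence

section Sum

variable [Fintype ι]

/-- The antisymmetric form on spin indices. -/
def spinForm (a b : Bool) : ℤ := if a = b then 0 else boolSign a

/-- The contribution of the `j`-th rearranged arc to the contraction with spin indices `x` at the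
junctions and `y` at the connections. -/
def arcWeight (x y : ι → Bool) (j : ι) : ℤ :=
  if flip j then
    (if x (π j) = y (c.symm j) then 1 else 0) * (if x (c.symm (π j)) = y j then 1 else 0)
  else spinForm (x (c.symm (π j))) (y (c.symm j)) * spinForm (x (π j)) (y j)

variable {c π flip}

/-- An arc violating compatibility has weight zero: the form vanishes on equal indices, the delta on
unequal ones. -/
theorem prod_arcWeight_of_not_compatible {x y : ι → Bool} (h : ¬ Compatible c π flip x y) :
    ∏ j, arcWeight c π flip x y j = 0 := by
  simp only [Compatible, not_forall] at h
  obtain ⟨j, hj⟩ := h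
  refine Finset.prod_eq_zero (Finset.mem_univ j) ?_
  revert hj
  rw [arcWeight, entry, exit]
  cases flip j <;> simp only [if_true, Bool.false_eq_true, if_false] <;>
    generalize x (π j) = a, x (c.symm (π j)) = b, y j = d, y (c.symm j) = e <;>
    revert a b d e <;> decide

variable [DecidableEq ι]

/-- The product of the surviving forms is the sign of the loop permutation. -/
theorem prod_arcWeight_of_compatible {x y : ι → Bool} (h : Compatible c π flip x y) :
    ∏ j, arcWeight c π flip x y j =
      (-1) ^ (Fintype.card ι - Nat.card (Quotient (connectionSetoid c π flip))) := by
  obtain ⟨τ, hτ, hs⟩ := exists_perm_of_compatible h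
  rw [← hτ]
  have := sign_eq_neg_one_pow_card_sub_card_quotient τ
  have h2 : ((Perm.sign τ : ℤˣ) : ℤ) = _ := congrArg _ this
  push_cast at h2
  rw [← h2, hs, Units.coe_prod]
  refine Finset.prod_congr rfl fun j _ => ?_
  obtain ⟨h3, h4⟩ := h j
  rw [arcWeight, h3, h4, entry, exit]
  cases flip j
  · simp [spinForm]
  · simp

theorem sum_prod_arcWeight :
    ∑ x : ι → Bool, ∑ y : ι → Bool, ∏ j, arcWeight c π flip x y j =
      (-1) ^ (Fintype.card ι - Nat.card (Quotient (connectionSetoid c π flip))) *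
        2 ^ Nat.card (Quotient (connectionSetoid c π flip)) := by
  classical
  rw [← Fintype.sum_prod_type'
    (f := fun x y : ι → Bool => ∏ j, arcWeight c π flip x y j)]
  rw [← Finset.sum_filter_add_sum_filter_not Finset.univ
    (fun z : (ι → Bool) × (ι → Bool) => Compatible c π flip z.1 z.2)]
  rw [Finset.sum_congr rfl fun z hz => prod_arcWeight_of_compatible (Finset.mem_filter.1 hz).2,
    Finset.sum_congr rfl fun z hz => prod_arcWeight_of_not_compatible (Finset.mem_filter.1 hz).2]
  rw [Finset.sum_const_zero, add_zero, Finset.sum_const, ← Fintype.card_subtype,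
    ← Nat.card_eq_fintype_card, card_compatible, nsmul_eq_mul, mul_comm]
  push_cast
  rfl

end Sum

end ArcGluing

/-! ### Traces of products of matrices -/

theorem list_ofFn_prod_apply {R m : Type*} [CommSemiring R] [Fintype m] [DecidableEq m] {n : ℕ}
    (M : Fin (n + 1) → Matrix m m R) (a b : m) :
    (List.ofFn M).prod a b = ∑ x : Fin n → m, ∏ i : Fin (n + 1),
      M i (Fin.cons (α := fun _ => m) a x i) (Fin.snoc (α := fun _ => m) x b i) := by
  induction n generalizing a with
  | zero =>
    simp
    rfl
  | succ n ih =>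
    rw [List.ofFn_succ, List.prod_cons, Matrix.mul_apply,
      ← (Fin.consEquiv fun _ => m).sum_comp, Fintype.sum_prod_type]
    refine Finset.sum_congr rfl fun d _ => ?_
    rw [ih, Finset.mul_sum]
    refine Finset.sum_congr rfl fun x _ => ?_
    change _ = ∏ i, M i (Fin.cons (α := fun _ => m) a (Fin.cons (α := fun _ => m) d x) i)
      (Fin.snoc (α := fun _ => m) (Fin.cons (α := fun _ => m) d x) b i)
    rw [← Fin.cons_snoc_eq_snoc_cons, Fin.prod_univ_succ (n := n + 1)]
    rfl

/-- The index `x i` sits between factor `i` and the cyclically next one, that is, at junction `i`.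
For `n = 0` the trace would be the size of `m`, while the sum is 1. -/
theorem trace_list_ofFn_prod {R m : Type*} [CommSemiring R] [Fintype m] [DecidableEq m] {n : ℕ}
    (hn : n ≠ 0) (M : Fin n → Matrix m m R) :
    (List.ofFn M).prod.trace =
      ∑ x : Fin n → m, ∏ i, M i (x ((finRotate n).symm i)) (x i) := by
  obtain ⟨n, rfl⟩ := Nat.exists_eq_succ_of_ne_zero hn
  rw [Matrix.trace, ← (Fin.snocEquiv fun _ => m).sum_comp, Fintype.sum_prod_type]
  refine Finset.sum_congr rfl fun a _ => ?_
  rw [Matrix.diag_apply, list_ofFn_prod_apply]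
  refine Finset.sum_congr rfl fun x _ => Finset.prod_congr rfl fun i _ => ?_
  simp only [Fin.snocEquiv_apply]
  congr 1
  rw [Fin.snoc_eq_cons_rotate x a]
  simp

/-! ### Spins of orbits as products of edge holonomies -/

section Holonomy

variable {E H : Type*} [Group H]

/-- The spin rotation acquired along a bond. -/
def bondSpin (u : Bond E → H) (b : Bond E) : H := u b * (u b.rev)⁻¹

theorem Bond.rev_rev (b : Bond E) : b.rev.rev = b := by simp [Bond.rev]

theorem Bond.rev_ne (b : Bond E) : b.rev ≠ b := by
  intro h
  have := congrArg Prod.snd h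
  simp [Bond.rev] at this

theorem bondSpin_rev (u : Bond E → H) (b : Bond E) : bondSpin u b.rev = (bondSpin u b)⁻¹ := by
  simp [bondSpin, Bond.rev_rev]

/-- The spin rotation acquired along an arc. -/
def arcSpin (u : Bond E → H) (l : List (Bond E)) : H := (l.map (bondSpin u)).prod

@[simp] theorem arcSpin_nil (u : Bond E → H) : arcSpin u [] = 1 := rfl

@[simp] theorem arcSpin_cons (u : Bond E → H) (b : Bond E) (l : List (Bond E)) :
    arcSpin u (b :: l) = bondSpin u b * arcSpin u l := by simp [arcSpin]

@[simp] theorem arcSpin_append (u : Bond E → H) (l l' : List (Bond E)) :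
    arcSpin u (l ++ l') = arcSpin u l * arcSpin u l' := by simp [arcSpin]

theorem arcSpin_reverseArc (u : Bond E → H) (l : List (Bond E)) :
    arcSpin u (reverseArc l) = (arcSpin u l)⁻¹ := by
  induction l with
  | nil => simp [reverseArc]
  | cons b l ih =>
    have : reverseArc (b :: l) = reverseArc l ++ [b.rev] := by simp [reverseArc]
    rw [this, arcSpin_append, ih]
    simp [bondSpin_rev]

theorem arcSpin_flatten (u : Bond E → H) (L : List (List (Bond E))) :
    arcSpin u L.flatten = (L.map (arcSpin u)).prod := by
  induction L with
  | nil => rfl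
  | cons l L ih => simp [ih]

theorem arcSpin_congr {u u' : Bond E → H} {l : List (Bond E)}
    (h : ∀ b ∈ l, u b = u' b ∧ u b.rev = u' b.rev) : arcSpin u l = arcSpin u' l := by
  unfold arcSpin
  congr 1
  exact List.map_congr_left fun b hb => by rw [bondSpin, bondSpin, (h b hb).1, (h b hb).2]

/-- Regrouping from vertices to edges: the two rotations of each inner bond become adjacent, and
only the outermost ones stay unpaired. -/
theorem prod_spinTransition_zip (u : Bond E → H) (b c : Bond E) (l : List (Bond E)) :
    (((b :: l).zip (l ++ [c])).map fun x => spinTransition u x.1 x.2).prod =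
      (u b.rev)⁻¹ * arcSpin u l * u c := by
  induction l generalizing b with
  | nil => simp [spinTransition]
  | cons d l ih =>
    rw [List.cons_append, List.zip_cons_cons, List.map_cons, List.prod_cons, ih, arcSpin_cons,
      spinTransition, bondSpin]
    group

end Holonomy

section Trace

variable {E : Type*} {Γ : Subgroup SU2}

theorem spinTrace_mul_comm (g h : Γ) : spinTrace (g * h) = spinTrace (h * g) := by
  simp only [spinTrace, Subgroup.coe_mul, Submonoid.coe_mul]
  exact Matrix.trace_mul_comm _ _

theorem spinTrace_orbitSpin (u : Bond E → Γ) (p : List (Bond E)) :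
    spinTrace (orbitSpin u p) = spinTrace (arcSpin u p) := by
  cases p with
  | nil => rfl
  | cons b l =>
    rw [orbitSpin, cyclicPairs, List.rotate_cons_succ, List.rotate_zero,
      prod_spinTransition_zip, spinTrace_mul_comm, arcSpin_cons, bondSpin, mul_assoc]

theorem spinTrace_arcSpin_of_isRotated (u : Bond E → Γ) {p q : List (Bond E)} (h : p ~r q) :
    spinTrace (arcSpin u p) = spinTrace (arcSpin u q) := by
  obtain ⟨n, hn, rfl⟩ := List.isRotated_iff_mod.1 h
  rw [List.rotate_eq_drop_append_take hn, arcSpin_append, spinTrace_mul_comm, ← arcSpin_append,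
    List.take_append_drop]

/-- The underlying matrix of an element of a subgroup of `SU(2)`. -/
def spinMatrix : Γ →* Matrix (Fin 2) (Fin 2) ℂ :=
  (Matrix.specialUnitaryGroup (Fin 2) ℂ).subtype.comp Γ.subtype

theorem spinTrace_eq (g : Γ) : spinTrace g = (spinMatrix g).trace := rfl

theorem det_spinMatrix (g : Γ) : (spinMatrix g).det = 1 :=
  (Matrix.mem_specialUnitaryGroup_iff.1 (g : SU2).2).2

theorem norm_spinMatrix_apply_le (g : Γ) (a b : Fin 2) : ‖spinMatrix g a b‖ ≤ 1 :=
  entry_norm_bound_of_unitary (Matrix.mem_specialUnitaryGroup_iff.1 (g : SU2).2).1 a b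

/-- Entries of the inverse are linear in those of `g`, so reversed arcs need no new moments. -/
theorem spinMatrix_inv (g : Γ) : spinMatrix g⁻¹ = (spinMatrix g).adjugate := by
  have h1 : spinMatrix g⁻¹ * spinMatrix g = 1 := by rw [← map_mul]; simp
  have h2 := Matrix.mul_adjugate (spinMatrix g)
  rw [det_spinMatrix, one_smul] at h2
  calc spinMatrix g⁻¹ = spinMatrix g⁻¹ * (spinMatrix g * (spinMatrix g).adjugate) := by
        rw [h2, mul_one]
    _ = _ := by rw [← mul_assoc, h1, one_mul]

theorem continuous_spinMatrix_apply (a b : Fin 2) : Continuous fun g : Γ => spinMatrix g a b :=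
  (Continuous.matrix_elem continuous_id a b).comp
    ((continuous_subtype_val (p := fun A => A ∈ Matrix.specialUnitaryGroup (Fin 2) ℂ)).comp
      continuous_subtype_val)

theorem continuous_iff_spinMatrix {X : Type*} [TopologicalSpace X] {f : X → Γ} :
    Continuous f ↔ ∀ a b, Continuous fun x => spinMatrix (f x) a b := by
  refine ⟨fun hf a b => (continuous_spinMatrix_apply a b).comp hf, fun hf => ?_⟩
  refine continuous_induced_rng.2 (continuous_induced_rng.2 ?_)
  exact continuous_matrix hf

instance : IsTopologicalGroup Γ where
  continuous_mul := by
    refine continuous_iff_spinMatrix.2 fun a b => ?_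
    simp only [map_mul, Matrix.mul_apply]
    exact continuous_finsetSum _ fun i _ => ((continuous_spinMatrix_apply a i).comp
      continuous_fst).mul ((continuous_spinMatrix_apply i b).comp continuous_snd)
  continuous_inv := by
    refine continuous_iff_spinMatrix.2 fun a b => ?_
    simp only [spinMatrix_inv, Matrix.adjugate_fin_two]
    have := fun a b => continuous_spinMatrix_apply (Γ := Γ) a b
    fin_cases a <;> fin_cases b
    · simpa using this 1 1
    · exact (this 0 1).neg
    · exact (this 1 0).neg
    · simpa using this 0 0

/-- Makes the product σ-algebra on families of rotations Borel, so that continuous integrands are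
measurable. -/
instance : SecondCountableTopology Γ :=
  haveI : SecondCountableTopology (Matrix (Fin 2) (Fin 2) ℂ) :=
    inferInstanceAs (SecondCountableTopology (Fin 2 → Fin 2 → ℂ))
  haveI : SecondCountableTopology SU2 := Topology.IsEmbedding.subtypeVal.secondCountableTopology
  Topology.IsEmbedding.subtypeVal.secondCountableTopology

theorem continuous_spinTrace : Continuous (spinTrace : Γ → ℂ) := by
  change Continuous fun g : Γ => ∑ i, spinMatrix g i i
  exact continuous_finsetSum _ fun i _ => continuous_spinMatrix_apply i i

theorem norm_spinTrace_le (g : Γ) : ‖spinTrace g‖ ≤ 2 := by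
  rw [spinTrace_eq, Matrix.trace_fin_two]
  refine (norm_add_le _ _).trans ?_
  have h0 := norm_spinMatrix_apply_le g 0 0
  have h1 := norm_spinMatrix_apply_le g 1 1
  linarith

end Trace

/-! ### Second moments of an irreducible subgroup -/

/-- The antisymmetric form on `ℂ²`. -/
def symplecticJ : Matrix (Fin 2) (Fin 2) ℂ := !![0, 1; -1, 0]

theorem symplecticJ_mul_self : symplecticJ * symplecticJ = -1 := by
  ext i j
  fin_cases i <;> fin_cases j <;> simp [symplecticJ]

theorem transpose_mul_symplecticJ_mul (A : Matrix (Fin 2) (Fin 2) ℂ) (hA : A.det = 1) :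
    A.transpose * symplecticJ * A = symplecticJ := by
  rw [Matrix.det_fin_two] at hA
  ext i j
  fin_cases i <;> fin_cases j <;> simp [symplecticJ, Matrix.mul_apply, Fin.sum_univ_two]
  · ring
  · linear_combination hA
  · linear_combination -hA
  · ring

section Moments

variable {Γ : Subgroup SU2}

/-- Schur's lemma over the algebraically closed field `ℂ`. -/
theorem exists_eq_smul_one_of_commute (hΓ : (spinRepresentation Γ).IsIrreducible)
    (K : Matrix (Fin 2) (Fin 2) ℂ) (hK : ∀ h : Γ, spinMatrix h * K = K * spinMatrix h) :
    ∃ c : ℂ, K = c • 1 := by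
  have hf : ∀ (g : Γ) (v : Fin 2 → ℂ), Matrix.toLin' K (spinRepresentation Γ g v) =
      spinRepresentation Γ g (Matrix.toLin' K v) := by
    intro g v
    change K.mulVec ((spinMatrix g).mulVec v) = (spinMatrix g).mulVec (K.mulVec v)
    rw [Matrix.mulVec_mulVec, Matrix.mulVec_mulVec, hK]
  let f := LinearMap.intertwiningMap_of_isIntertwiningMap _ _ (Matrix.toLin' K) hf
  obtain ⟨c, hc⟩ :=
    (Representation.IsIrreducible.algebraMap_intertwiningMap_bijective_of_isAlgClosed
      (ρ := spinRepresentation Γ)).2 f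
  refine ⟨c, ?_⟩
  apply Matrix.toLin'.injective
  refine LinearMap.ext fun v => ?_
  have h1 : f v = c • v := by rw [← hc]; rfl
  have h2 : f v = Matrix.toLin' K v := rfl
  rw [← h2, h1]
  simp

variable [MeasurableSpace Γ] [BorelSpace Γ] (μ : Measure Γ)

theorem integrable_spinMatrix_mul [IsFiniteMeasure μ] (L X : Γ) (a b c d : Fin 2) :
    Integrable (fun g => spinMatrix (L * g * X) a b * spinMatrix (L * g * X) c d) μ := by
  refine Integrable.of_bound (C := 1) (Continuous.aestronglyMeasurable ?_) ?_
  · have h : Continuous fun g : Γ => L * g * X :=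
      (continuous_const.mul continuous_id).mul continuous_const
    exact ((continuous_spinMatrix_apply a b).comp h).mul ((continuous_spinMatrix_apply c d).comp h)
  · refine Filter.Eventually.of_forall fun g => ?_
    rw [norm_mul]
    exact mul_le_one₀ (norm_spinMatrix_apply_le _ _ _) (norm_nonneg _)
      (norm_spinMatrix_apply_le _ _ _)

variable [μ.IsHaarMeasure] [IsProbabilityMeasure μ]

/-- For fixed `b` and `d`, left invariance of the measure gives `h F hᵀ = F`. Since `hᵀ J h = J`,
the matrix `F J` commutes with `Γ`, hence is scalar and `F` is a multiple of `J`. -/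
theorem integral_spinMatrix_mul_right (hΓ : (spinRepresentation Γ).IsIrreducible) (X : Γ)
    (a b c d : Fin 2) :
    ∫ g, spinMatrix (g * X) a b * spinMatrix (g * X) c d ∂μ =
      1 / 2 * symplecticJ a c * symplecticJ b d := by
  let F : Matrix (Fin 2) (Fin 2) ℂ := Matrix.of fun a c =>
    ∫ g, spinMatrix (g * X) a b * spinMatrix (g * X) c d ∂μ
  have hint : ∀ a c, Integrable
      (fun g => spinMatrix (g * X) a b * spinMatrix (g * X) c d) μ := fun a c => by
    simpa using integrable_spinMatrix_mul μ 1 X a b c d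
  have hF : ∀ a c, F a c = ∫ g, spinMatrix (g * X) a b * spinMatrix (g * X) c d ∂μ :=
    fun _ _ => rfl
  have hinv : ∀ h : Γ, spinMatrix h * F * (spinMatrix h).transpose = F := by
    intro h
    ext a c
    have e : F a c = ∫ g, ∑ i, (∑ j, spinMatrix h a j *
        (spinMatrix (g * X) j b * spinMatrix (g * X) i d)) * spinMatrix h c i ∂μ := by
      rw [hF, ← integral_mul_left_eq_self _ h]
      refine integral_congr_ae (Filter.Eventually.of_forall fun g => ?_)
      simp only [mul_assoc, map_mul spinMatrix h, Matrix.mul_apply, Fin.sum_univ_two]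
      ring
    rw [e, integral_finsetSum _ fun i _ =>
      (integrable_finsetSum _ fun j _ => (hint j i).const_mul _).mul_const _]
    rw [Matrix.mul_apply]
    refine Finset.sum_congr rfl fun i _ => ?_
    rw [integral_mul_const, integral_finsetSum _ fun j _ => (hint j i).const_mul _,
      Matrix.mul_apply, Matrix.transpose_apply]
    congr 1
    refine Finset.sum_congr rfl fun j _ => ?_
    rw [integral_const_mul, hF]
  obtain ⟨l, hl⟩ := exists_eq_smul_one_of_commute hΓ (F * symplecticJ) fun h => by
    have h1 := transpose_mul_symplecticJ_mul (spinMatrix h) (det_spinMatrix h)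
    conv_rhs => rw [← hinv h]
    simp only [mul_assoc] at h1 ⊢
    rw [h1]
  have hF2 : F = (-l) • symplecticJ := by
    calc F = -(F * symplecticJ * symplecticJ) := by
          rw [mul_assoc, symplecticJ_mul_self, mul_neg, mul_one, neg_neg]
      _ = _ := by rw [hl, smul_mul_assoc, one_mul, neg_smul]
  -- The multiple is fixed by the antisymmetric part of `F`, whose integrand is constant, again
  -- because `gᵀ J g = J`.
  have htr : F 0 1 - F 1 0 = symplecticJ b d := by
    rw [hF, hF, ← integral_sub (hint 0 1) (hint 1 0)]
    have : ∀ g : Γ, spinMatrix (g * X) 0 b * spinMatrix (g * X) 1 d -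
        spinMatrix (g * X) 1 b * spinMatrix (g * X) 0 d = symplecticJ b d := fun g => by
      conv_rhs => rw [← transpose_mul_symplecticJ_mul _ (det_spinMatrix (g * X))]
      simp [symplecticJ, Matrix.mul_apply, Fin.sum_univ_two]
      ring
    simp only [this, integral_const, probReal_univ, one_smul]
  rw [← hF]
  rw [hF2] at htr ⊢
  simp only [Matrix.smul_apply, smul_eq_mul] at htr ⊢
  have hl2 : -l = 1 / 2 * symplecticJ b d := by
    simp [symplecticJ] at htr ⊢
    linear_combination htr / 2
  rw [hl2]
  ring

theorem integral_spinMatrix_mul (hΓ : (spinRepresentation Γ).IsIrreducible) (L X : Γ)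
    (a b c d : Fin 2) :
    ∫ g, spinMatrix (L * g * X) a b * spinMatrix (L * g * X) c d ∂μ =
      1 / 2 * symplecticJ a c * symplecticJ b d := by
  rw [← integral_spinMatrix_mul_right μ hΓ X a b c d]
  exact integral_mul_left_eq_self
    (fun g => spinMatrix (g * X) a b * spinMatrix (g * X) c d) L

end Moments

/-! ### Independent averages over the arcs -/

section Average

theorem symplecticJ_finTwoEquiv (a b : Bool) :
    symplecticJ (finTwoEquiv.symm a) (finTwoEquiv.symm b) = (ArcGluing.spinForm a b : ℂ) := by
  cases a <;> cases b <;> simp [symplecticJ, ArcGluing.spinForm, boolSign, finTwoEquiv]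

variable {Γ : Subgroup SU2} [MeasurableSpace Γ] [BorelSpace Γ] (μ : Measure Γ)
  [μ.IsHaarMeasure] [IsProbabilityMeasure μ]

theorem integral_spinMatrix_mul_inv (hΓ : (spinRepresentation Γ).IsIrreducible) (L X : Γ)
    (a b c d : Fin 2) :
    ∫ g, spinMatrix (L * g * X) a b * spinMatrix (L * g * X)⁻¹ c d ∂μ =
      1 / 2 * ((if b = c then 1 else 0) * (if a = d then 1 else 0)) := by
  have h := integral_spinMatrix_mul μ hΓ L X a b
  simp only [spinMatrix_inv, Matrix.adjugate_fin_two]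
  fin_cases c <;> fin_cases d <;>
    simp only [Fin.zero_eta, Fin.mk_one, Matrix.of_apply, Matrix.cons_val_zero,
      Matrix.cons_val_one, Matrix.cons_val', Matrix.cons_val_fin_one, mul_neg, integral_neg, h] <;>
    fin_cases a <;> fin_cases b <;> simp [symplecticJ]

theorem integral_spinMatrix_mul_ite (hΓ : (spinRepresentation Γ).IsIrreducible) {ι : Type*}
    (σ π : Equiv.Perm ι) (flip : ι → Bool) (x y : ι → Bool) (j : ι) (L X : Γ) :
    ∫ g, spinMatrix (L * g * X) (finTwoEquiv.symm (x (σ.symm (π j)))) (finTwoEquiv.symm (x (π j))) *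
      spinMatrix (if flip j then (L * g * X)⁻¹ else L * g * X)
        (finTwoEquiv.symm (y (σ.symm j))) (finTwoEquiv.symm (y j)) ∂μ =
      1 / 2 * (ArcGluing.arcWeight σ π flip x y j : ℂ) := by
  cases hf : flip j
  · simp only [Bool.false_eq_true, if_false]
    rw [integral_spinMatrix_mul μ hΓ, symplecticJ_finTwoEquiv, symplecticJ_finTwoEquiv,
      ArcGluing.arcWeight, hf]
    simp [mul_assoc]
  · simp only [if_true]
    rw [integral_spinMatrix_mul_inv μ hΓ, ArcGluing.arcWeight, hf]
    simp

omit [μ.IsHaarMeasure] in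
theorem integrable_spinMatrix_mul_ite (f : Bool) (a b c d : Fin 2) (L X : Γ) :
    Integrable (fun g => spinMatrix (L * g * X) a b *
      spinMatrix (if f then (L * g * X)⁻¹ else L * g * X) c d) μ := by
  cases f
  · exact integrable_spinMatrix_mul μ L X a b c d
  · have h := integrable_spinMatrix_mul μ L X a b
    simp only [if_true, spinMatrix_inv, Matrix.adjugate_fin_two]
    fin_cases c <;> fin_cases d
    · exact h 1 1
    · simpa using (h 0 1).neg
    · simpa using (h 1 0).neg
    · exact h 0 0

omit [BorelSpace Γ] [μ.IsHaarMeasure] in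
theorem integral_prod_comp_equiv {ι T : Type*} [Fintype ι] [Fintype T] (e : ι ≃ T)
    (f : ι → Γ → ℂ) :
    ∫ s : T → Γ, ∏ j, f j (s (e j)) ∂(Measure.pi fun _ => μ) = ∏ j, ∫ g, f j g ∂μ := by
  rw [← e.symm.prod_comp, ← integral_fintype_prod_eq_prod]
  refine integral_congr_ae (Filter.Eventually.of_forall fun s => ?_)
  dsimp only
  rw [← e.symm.prod_comp]
  simp

omit [BorelSpace Γ] [μ.IsHaarMeasure] in
theorem integrable_prod_comp_equiv {ι T : Type*} [Fintype ι] [Fintype T] (e : ι ≃ T)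
    {f : ι → Γ → ℂ} (hf : ∀ j, Integrable (f j) μ) :
    Integrable (fun s : T → Γ => ∏ j, f j (s (e j))) (Measure.pi fun _ => μ) := by
  have := Integrable.fintype_prod (ι := T) (μ := fun _ => μ) (f := fun t => f (e.symm t))
    fun t => hf _
  refine this.congr (Filter.Eventually.of_forall fun s => ?_)
  dsimp only
  rw [← e.prod_comp]
  simp

theorem integral_trace_mul_trace (hΓ : (spinRepresentation Γ).IsIrreducible) {k : ℕ} (hk : k ≠ 0)
    {T : Type*} [Fintype T] (e : Fin k ≃ T) (π : Equiv.Perm (Fin k)) (flip : Fin k → Bool)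
    (L X : Fin k → Γ) :
    ∫ s : T → Γ, (List.ofFn fun i => spinMatrix (L i * s (e i) * X i)).prod.trace *
      (List.ofFn fun j => spinMatrix (if flip j then (L (π j) * s (e (π j)) * X (π j))⁻¹ else
        L (π j) * s (e (π j)) * X (π j))).prod.trace ∂(Measure.pi fun _ => μ) =
      (-1 / 2) ^ (k - Nat.card (Quotient (ArcGluing.connectionSetoid (finRotate k) π flip))) := by
  let E := Equiv.arrowCongr (Equiv.refl (Fin k)) finTwoEquiv
  let F : (Fin k → Bool) → (Fin k → Bool) → Fin k → Γ → ℂ := fun x y j g =>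
    spinMatrix (L (π j) * g * X (π j)) (finTwoEquiv.symm (x ((finRotate k).symm (π j))))
        (finTwoEquiv.symm (x (π j))) *
      spinMatrix (if flip j then (L (π j) * g * X (π j))⁻¹ else L (π j) * g * X (π j))
        (finTwoEquiv.symm (y ((finRotate k).symm j))) (finTwoEquiv.symm (y j))
  have hF : ∀ x y j, Integrable (F x y j) μ := fun x y j =>
    integrable_spinMatrix_mul_ite μ _ _ _ _ _ _ _
  have hint : ∀ x y, Integrable (fun s : T → Γ => ∏ j, F x y j (s ((π.trans e) j)))
      (Measure.pi fun _ => μ) := fun x y => integrable_prod_comp_equiv μ _ (hF x y)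
  have hsum : ∀ s : T → Γ,
      (List.ofFn fun i => spinMatrix (L i * s (e i) * X i)).prod.trace *
      (List.ofFn fun j => spinMatrix (if flip j then (L (π j) * s (e (π j)) * X (π j))⁻¹ else
        L (π j) * s (e (π j)) * X (π j))).prod.trace =
      ∑ x : Fin k → Bool, ∑ y : Fin k → Bool, ∏ j, F x y j (s ((π.trans e) j)) := by
    intro s
    rw [trace_list_ofFn_prod hk, trace_list_ofFn_prod hk, ← E.symm.sum_comp, ← E.symm.sum_comp,
      Finset.sum_mul_sum]
    refine Finset.sum_congr rfl fun x _ => Finset.sum_congr rfl fun y _ => ?_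
    rw [← Equiv.prod_comp π, ← Finset.prod_mul_distrib]
    rfl
  simp_rw [hsum]
  rw [integral_finsetSum _ fun x _ => integrable_finsetSum _ fun y _ => hint x y]
  simp_rw [integral_finsetSum _ fun y _ => hint _ y, integral_prod_comp_equiv, F,
    integral_spinMatrix_mul_ite μ hΓ, Finset.prod_mul_distrib]
  rw [Finset.prod_const, Finset.card_univ, Fintype.card_fin]
  simp_rw [← Finset.mul_sum]
  have h := congrArg (Int.cast : ℤ → ℂ)
    (ArcGluing.sum_prod_arcWeight (c := finRotate k) (π := π) (flip := flip))
  push_cast at h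
  rw [h, Fintype.card_fin]
  have hle := ArcGluing.card_quotient_le (c := finRotate k) (π := π) (flip := flip)
  rw [Nat.card_fin] at hle
  generalize Nat.card _ = v at hle ⊢
  -- Writing `k = v + w` removes the truncated subtraction.
  obtain ⟨w, rfl⟩ := Nat.exists_eq_add_of_le hle
  rw [Nat.add_sub_cancel_left, pow_add, div_pow, div_pow, div_pow]
  field_simp
  simp

end Average

/-! ### Integrability over all vertex rotations. -/

section Fubini

variable {E : Type*} {Γ : Subgroup SU2}

theorem continuous_arcSpin (l : List (Bond E)) : Continuous fun u : Bond E → Γ => arcSpin u l := by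
  induction l with
  | nil => exact continuous_const
  | cons b l ih =>
    simp only [arcSpin_cons, bondSpin]
    exact ((continuous_apply b).mul (continuous_apply b.rev).inv).mul ih

theorem integrable_spinTrace_mul [Fintype E] [MeasurableSpace Γ] [BorelSpace Γ] (μ : Measure Γ)
    [IsProbabilityMeasure μ] (p q : List (Bond E)) :
    Integrable (fun u : Bond E → Γ => spinTrace (arcSpin u p) * spinTrace (arcSpin u q))
      (Measure.pi fun _ => μ) := by
  refine Integrable.of_bound (C := 2 * 2) (Continuous.aestronglyMeasurable ?_) ?_
  · exact (continuous_spinTrace.comp (continuous_arcSpin p)).mul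
      (continuous_spinTrace.comp (continuous_arcSpin q))
  · refine Filter.Eventually.of_forall fun u => ?_
    rw [norm_mul]
    exact mul_le_mul (norm_spinTrace_le _) (norm_spinTrace_le _) (norm_nonneg _) (by norm_num)

end Fubini

/-! ### Orbit traces through arcs, and uniqueness of the marked edges. -/

namespace ArcRearrangement

variable {E : Type*} {p q : List (Bond E)} (R : ArcRearrangement p q)

theorem intersectionSetoid_eq :
    R.intersectionSetoid = ArcGluing.connectionSetoid (finRotate R.k) R.perm R.flip := rfl

/-- The classes partition the `k` junctions, and none is empty, so each truncated `|c| - 1` is a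
true difference. -/
theorem numSelfIntersections_eq : R.numSelfIntersections =
    R.k - Nat.card (Quotient (ArcGluing.connectionSetoid (finRotate R.k) R.perm R.flip)) := by
  classical
  rw [← intersectionSetoid_eq, numSelfIntersections, finsum_eq_sum_of_fintype]
  have hpos : ∀ c, 1 ≤ R.multiplicity c := fun c => by
    obtain ⟨i, rfl⟩ := Quotient.exists_rep c
    exact Nat.card_pos_iff.2 ⟨⟨⟨i, rfl⟩⟩, inferInstance⟩
  have hsum : ∑ c, R.multiplicity c = R.k := by
    unfold multiplicity
    rw [← Nat.card_sigma, Nat.card_congr (Equiv.sigmaFiberEquiv _), Nat.card_fin]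
  have : ∑ c, (R.multiplicity c - 1) + ∑ _c : R.Intersection, 1 = R.k := by
    rw [← Finset.sum_add_distrib]
    refine Eq.trans ?_ hsum
    exact Finset.sum_congr rfl fun c _ => Nat.sub_add_cancel (hpos c)
  rw [Finset.sum_const, Finset.card_univ, smul_eq_mul, mul_one, ← Nat.card_eq_fintype_card] at this
  exact Nat.eq_sub_of_add_eq this

theorem sum_count_arc [DecidableEq E] (e : E) :
    ∑ i, ((R.arc i).map Prod.fst).count e = (p.map Prod.fst).count e := by
  rw [(R.p_eq.perm.map Prod.fst).count_eq, List.map_flatten, List.count_flatten, List.map_ofFn,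
    List.map_ofFn, List.sum_ofFn]
  rfl

variable {Γ : Subgroup SU2}

theorem spinTrace_arcSpin_left (u : Bond E → Γ) : spinTrace (arcSpin u p) =
    (List.ofFn fun i => spinMatrix (arcSpin u (R.arc i))).prod.trace := by
  rw [spinTrace_arcSpin_of_isRotated u R.p_eq, arcSpin_flatten, spinTrace_eq, map_list_prod,
    List.map_ofFn, List.map_ofFn]
  rfl

theorem spinTrace_arcSpin_right (u : Bond E → Γ) : spinTrace (arcSpin u q) =
    (List.ofFn fun j => spinMatrix (if R.flip j then (arcSpin u (R.arc (R.perm j)))⁻¹ else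
      arcSpin u (R.arc (R.perm j)))).prod.trace := by
  rw [spinTrace_arcSpin_of_isRotated u R.q_eq, arcSpin_flatten, spinTrace_eq, map_list_prod,
    List.map_ofFn, List.map_ofFn]
  congr 3
  funext j
  simp only [Function.comp_apply]
  split_ifs <;> simp [arcSpin_reverseArc]

end ArcRearrangement

namespace ArcRearrangement

variable {E : Type*} [DecidableEq E] {p q : List (Bond E)} (R : ArcRearrangement p q)

theorem eq_of_mem_arc_of_count_eq_one {i i' : Fin R.k} {b b' : Bond E} (hb : b ∈ R.arc i)
    (hb' : b' ∈ R.arc i') (he : b'.1 = b.1) (h : (p.map Prod.fst).count b.1 = 1) : i' = i := by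
  by_contra hne
  have h1 : 0 < ((R.arc i).map Prod.fst).count b.1 :=
    List.count_pos_iff.2 (List.mem_map_of_mem hb)
  have h2 : 0 < ((R.arc i').map Prod.fst).count b.1 :=
    List.count_pos_iff.2 (he ▸ List.mem_map_of_mem hb')
  have h3 := Finset.sum_le_sum_of_subset (f := fun i => ((R.arc i).map Prod.fst).count b.1)
    (Finset.subset_univ {i', i})
  rw [Finset.sum_pair hne, R.sum_count_arc, h] at h3
  omega

theorem ne_of_mem_of_count_eq_one {i : Fin R.k} {b b' : Bond E} {l r : List (Bond E)}
    (hi : R.arc i = l ++ b :: r) (h : (p.map Prod.fst).count b.1 = 1)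
    (hb' : b' ∈ l ∨ b' ∈ r) : b'.1 ≠ b.1 := by
  intro he
  have h1 := Finset.single_le_sum (f := fun i => ((R.arc i).map Prod.fst).count b.1)
    (fun _ _ => Nat.zero_le _) (Finset.mem_univ i)
  rw [R.sum_count_arc, h] at h1
  simp only [hi, List.map_append, List.map_cons, List.count_append, List.count_cons_self] at h1
  have h2 : 0 < (l.map Prod.fst).count b.1 + (r.map Prod.fst).count b.1 := by
    rcases hb' with hb' | hb'
    · exact Nat.add_pos_left (List.count_pos_iff.2 (he ▸ List.mem_map_of_mem hb')) _
    · exact Nat.add_pos_right _ (List.count_pos_iff.2 (he ▸ List.mem_map_of_mem hb'))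
  omega

end ArcRearrangement

/-! ### The average, by conditioning on the unmarked rotations. -/

theorem mainTheorem4 {V E : Type*} [Fintype E] [DecidableEq E] (G : OrientedGraph V E)
    (Γ : Subgroup SU2) (hΓ : (spinRepresentation Γ).IsIrreducible)
    [MeasurableSpace Γ] [BorelSpace Γ]
    (μ : Measure Γ) [μ.IsHaarMeasure] [IsProbabilityMeasure μ]
    (p q : List (Bond E)) (hp : G.IsPeriodicOrbit p) (hq : G.IsPeriodicOrbit q)
    (R : ArcRearrangement p q)
    (hR : ∀ i, ∃ b ∈ R.arc i, (p.map Prod.fst).count b.1 = 1)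
    (m : ℕ) (hm : m = R.numSelfIntersections + 1) :
    spinAverage Γ μ p q = (-1 / 2 : ℂ) ^ (m - 1) := by
  classical
  rw [hm, Nat.add_sub_cancel, R.numSelfIntersections_eq]
  choose b hb hcount using hR
  choose l r hlr using fun i => List.append_of_mem (hb i)
  have hedge : ∀ {i i' b'}, b' ∈ R.arc i' → b'.1 = (b i).1 → i' = i := fun {i} {i'} {b'} h he =>
    R.eq_of_mem_arc_of_count_eq_one (hb i) h he (hcount i)
  have hbinj : Function.Injective b := fun i i' h => hedge (hb i) (congrArg Prod.fst h)
  have hnot : ∀ {i b'}, b' ∈ l i ∨ b' ∈ r i → ∀ i', b'.1 ≠ (b i').1 := by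
    intro i b' h i' he
    have hmem : b' ∈ R.arc i := by
      rw [hlr i]
      rcases h with h | h <;> simp [h]
    obtain rfl := hedge hmem he
    exact R.ne_of_mem_of_count_eq_one (hlr i) (hcount i) h he
  let P : Bond E → Prop := fun c => c ∈ Set.range b
  let _ : Fintype {c // P c} := Subtype.fintype P
  let e : Fin R.k ≃ {c // P c} := Equiv.ofInjective b hbinj
  -- The rotation at the far end of a marked edge belongs to the conditioned variables.
  have hrev : ∀ i, ¬ P (b i).rev := by
    rintro i ⟨i', hi'⟩
    obtain rfl := hedge (hb i') (congrArg Prod.fst hi' : (b i').1 = (b i).rev.1)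
    exact Bond.rev_ne _ hi'.symm
  let glue := (MeasurableEquiv.piEquivPiSubtypeProd (fun _ : Bond E => Γ) P).symm
  have hglue : ∀ s t c, glue (s, t) c = if h : P c then s ⟨c, h⟩ else t ⟨c, h⟩ :=
    fun _ _ _ => rfl
  have hglueP : ∀ s t i, glue (s, t) (b i) = s (e i) := fun s t i => by
    rw [hglue, dif_pos ⟨i, rfl⟩]
    rfl
  have hglueN : ∀ s s' t c, ¬ P c → glue (s, t) c = glue (s', t) c := fun s s' t c h => by
    rw [hglue, hglue, dif_neg h, dif_neg h]
  -- Outside the marked bonds nothing depends on `s`, so the arbitrary value `1` replaces it in the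
  -- fixed factors.
  have harc : ∀ t s i, arcSpin (glue (s, t)) (R.arc i) =
      arcSpin (glue (1, t)) (l i) * s (e i) *
        ((glue (1, t) (b i).rev)⁻¹ * arcSpin (glue (1, t)) (r i)) := by
    intro t s i
    have hcongr : ∀ c : List (Bond E), (∀ b' ∈ c, b' ∈ l i ∨ b' ∈ r i) →
        arcSpin (glue (s, t)) c = arcSpin (glue (1, t)) c := fun c hc =>
      arcSpin_congr fun b' hb' => by
        have := hnot (hc b' hb')
        constructor <;> refine hglueN _ _ _ _ ?_ <;> rintro ⟨i', hi'⟩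
        · exact this i' (congrArg Prod.fst hi').symm
        · exact this i' (congrArg Prod.fst hi').symm
    rw [hlr i, arcSpin_append, arcSpin_cons, hcongr (l i) fun _ => Or.inl,
      hcongr (r i) fun _ => Or.inr, bondSpin, hglueP, hglueN s 1 t _ (hrev i)]
    simp only [mul_assoc]
  have hmp := (measurePreserving_piEquivPiSubtypeProd (fun _ : Bond E => μ) P).symm
  have hint := integrable_spinTrace_mul μ p q
  rw [← hmp.integrable_comp_emb (MeasurableEquiv.measurableEmbedding _)] at hint
  simp only [spinAverage, spinTrace_orbitSpin]
  rw [← hmp.integral_comp']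
  -- The marked rotations are integrated first; the inner integral does not depend on `t`, and the
  -- remaining measure has mass one.
  refine (integral_prod_symm _ hint).trans ?_
  have hinner : ∀ t : {c // ¬ P c} → Γ, ∫ s : {c // P c} → Γ,
      spinTrace (arcSpin (glue (s, t)) p) * spinTrace (arcSpin (glue (s, t)) q)
        ∂(Measure.pi fun _ => μ) = (-1 / 2) ^ (R.k -
          Nat.card (Quotient (ArcGluing.connectionSetoid (finRotate R.k) R.perm R.flip))) := by
    intro t
    rw [← integral_trace_mul_trace μ hΓ R.k_ne_zero e R.perm R.flip
      (fun i => arcSpin (glue (1, t)) (l i))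
      (fun i => (glue (1, t) (b i).rev)⁻¹ * arcSpin (glue (1, t)) (r i))]
    simp only [R.spinTrace_arcSpin_left, R.spinTrace_arcSpin_right, harc]
  refine (integral_congr_ae (Filter.Eventually.of_forall hinner)).trans ?_
  simp only [integral_const, probReal_univ, one_smul]
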